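/- **Theorem (Duality).** *Conventions.* For a rank $\mathbf d$, i.e. finitely many coordinates $X^1,\dots,X^N$ of $\mathbb R^N$ with positive integer weights, let $\mathcal A(\mathbb R^{\mathbf d})=\mathbb R[X^1,\dots,X^N]$ be filtered by the subspaces $\mathcal A_n$ of weighted polynomials of degree $\le n$. A *filtered bundle* is a locally trivial bundle $F\to M$ over a smooth manifold with typical fibre $\mathbb R^{\mathbf d}$, whose transition functions express each new fibre coordinate of weight $w$ as a weighted polynomial of degree $\le w$ in the old fibre coordinates, with coefficients smooth on $M$. A morphism $F\to G$ is a map of bundles over a smooth map $\varphi$ of the bases which in adapted coordinates pulls every fibre coordinate of weight $w$ back to a weighted polynomial of degree $\le w$ with coefficients smooth on the base. A *filtered polynomial algebra bundle* is a locally trivial bundle of commutative filtered $\mathbb R$-algebras over a smooth manifold with typical fibre $\mathcal A(\mathbb R^{\mathbf d})$ and with transition functions that are automorphisms of the filtered algebra $\mathcal A(\mathbb R^{\mathbf d})$ depending smoothly on the base point. A morphism $\mathbb G\to\mathbb F$ of such bundles over $N$ and $M$ consists of a smooth map $\varphi:M\to N$ and of filtered algebra homomorphisms $\mathbb G_{\varphi(x)}\to\mathbb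 F_x$ depending smoothly on $x\in M$. Let $\mathbb A=\mathbb R[\varepsilon]$ be filtered by degree, with $\varepsilon^k$ of weight $k$. For a filtered bundle $F$, let $\mathrm{Hom}_f(F_x,\mathbb A)$ be the set of filtered morphisms $F_x\to\mathbb A$: maps $f$ with values in some $\mathbb A_n$ such that for each $k$ the coefficient of $\varepsilon^k$ in $f$ is a weighted polynomial of degree $\le k$ in the fibre coordinates; two of them are identified if they agree at $\varepsilon=1$. The operations are pointwise, and the $n$-th filtration part consists of the classes of morphisms with values in $\mathbb A_n$ (so this is the filtered algebra of polynomial functions on $F_x$). For a filtered polynomial algebra bundle $\mathbb F$, let $\mathrm{Hom}_{f\text{-}alg}(\mathbb F_x,\mathbb A)$ be the set of filtered algebra homomorphisms $\mathbb F_x\to\mathbb A$, again identified if they agree at $\varepsilon=1$. Trivializations of $F$, respectively of $\mathbb F$, induce trivializations of the resulting bundles over the same base. *Statement.* The associations $F\mapsto \mathrm{Hom}_f(F,\mathbb A)$ and $\mathbb F\mapsto \mathrm{Hom}_{f\text{-}alg}(\mathbb F,\mathbb A)$ yield filtered polynomial algebra bundles and filtered bundles, respectively. Acting on morphisms by composition,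 they are contravariant functors and are mutually quasi-inverse, so that they establish a (contravariant) equivalence between the category of filtered bundles and the category of filtered polynomial algebra bundles. Moreover, the identification of $F$ with its bidual $\mathrm{Hom}_{f\text{-}alg}(\mathrm{Hom}_f(F,\mathbb A),\mathbb A)$ can be taken to be the evaluation at the points of $F$, and it is then natural in $F$. -/

import Mathlib

open scoped Manifold ContDiff

universe u

namespace FiltDual

noncomputable section

/-! ### Smooth manifolds and weighted polynomials -/

/-- A smooth manifold: Hausdorff, second countable, modelled on `ℝ ^ dim`. -/
structure SmoothMfd where
  carrier : Type u
  dim : ℕ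
  [top : TopologicalSpace carrier]
  [charted : ChartedSpace (EuclideanSpace ℝ (Fin dim)) carrier]
  [mfd : IsManifold (𝓡 dim) ∞ carrier]
  [t2 : T2Space carrier]
  [sc : SecondCountableTopology carrier]

attribute [instance] SmoothMfd.top SmoothMfd.charted SmoothMfd.mfd SmoothMfd.t2 SmoothMfd.sc

instance : CoeSort SmoothMfd.{u} (Type u) := ⟨SmoothMfd.carrier⟩

/-- A rank: finitely many coordinates, each carrying a positive weight.
The rank `(d₁, …, d_k)` counts the coordinates of weight `1, …, k`. -/
structure Rank where
  num : ℕ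
  wt : Fin num → ℕ
  pos : ∀ i, 0 < wt i

namespace Rank

/-- The typical fibre `ℝ^d`. -/
abbrev Space (d : Rank) : Type := Fin d.num → ℝ

/-- The polynomial algebra `𝒜(ℝ^d)`. -/
abbrev Alg (d : Rank) : Type := MvPolynomial (Fin d.num) ℝ

/-- The filtration of `𝒜(ℝ^d)`: the weighted polynomials of degree at most `n`. -/
def fil (d : Rank) (n : ℕ) : Submodule ℝ d.Alg where
  carrier := {p | MvPolynomial.weightedTotalDegree d.wt p ≤ n}
  zero_mem' := by simp [MvPolynomial.weightedTotalDegree_zero]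
  add_mem' := by
    classical
    intro a b ha hb
    simp only [Set.mem_ofPred_eq, MvPolynomial.weightedTotalDegree, Finset.sup_le_iff] at *
    intro m hm
    rcases Finset.mem_union.1 (MvPolynomial.support_add hm) with h | h
    · exact ha m h
    · exact hb m h
  smul_mem' := by
    intro c a ha
    simp only [Set.mem_ofPred_eq, MvPolynomial.weightedTotalDegree, Finset.sup_le_iff] at *
    exact fun m hm => ha m (MvPolynomial.support_smul hm)

theorem mem_fil {d : Rank} {n : ℕ} {p : d.Alg} :
    p ∈ d.fil n ↔ ∀ m ∈ p.support, Finsupp.weight d.wt m ≤ n := by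
  change MvPolynomial.weightedTotalDegree d.wt p ≤ n ↔ _
  simp [MvPolynomial.weightedTotalDegree, Finset.sup_le_iff]

theorem fil_mono {d : Rank} {m n : ℕ} (h : m ≤ n) {p : d.Alg} (hp : p ∈ d.fil m) :
    p ∈ d.fil n := mem_fil.2 fun k hk => (mem_fil.1 hp k hk).trans h

theorem mul_mem_fil {d : Rank} {m n : ℕ} {p q : d.Alg} (hp : p ∈ d.fil m) (hq : q ∈ d.fil n) :
    p * q ∈ d.fil (m + n) := by
  classical
  refine mem_fil.2 fun k hk => ?_
  obtain ⟨a, ha, b, hb, rfl⟩ := Finset.mem_add.1 (MvPolynomial.support_mul p q hk)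
  rw [map_add]
  exact add_le_add (mem_fil.1 hp a ha) (mem_fil.1 hq b hb)

theorem C_mem_fil (d : Rank) (n : ℕ) (c : ℝ) : (MvPolynomial.C c : d.Alg) ∈ d.fil n := by
  classical
  refine mem_fil.2 fun k hk => ?_
  have : k = 0 := by
    by_contra h
    rw [MvPolynomial.mem_support_iff, MvPolynomial.coeff_C, if_neg (Ne.symm h)] at hk
    exact hk rfl
  simp [this]

theorem X_mem_fil (d : Rank) (i : Fin d.num) : (MvPolynomial.X i : d.Alg) ∈ d.fil (d.wt i) := by
  classical
  refine mem_fil.2 fun k hk => ?_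
  rw [MvPolynomial.mem_support_iff, MvPolynomial.coeff_X] at hk
  have : Finsupp.single i 1 = k := by
    by_contra h
    rw [if_neg h] at hk
    exact hk rfl
  simp [← this, Finsupp.weight_single]

theorem prod_pow_mem_fil {d d' : Rank} {T : Fin d.num → d'.Alg}
    (hT : ∀ i, T i ∈ d'.fil (d.wt i)) (m : Fin d.num →₀ ℕ) :
    (∏ i, T i ^ m i) ∈ d'.fil (Finsupp.weight d.wt m) := by
  classical
  have hpow : ∀ i k, T i ^ k ∈ d'.fil (k * d.wt i) := by
    intro i k
    induction k with
    | zero => simpa using C_mem_fil d' _ 1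
    | succ k ih => rw [pow_succ, Nat.succ_mul]; exact mul_mem_fil ih (hT i)
  have : ∀ s : Finset (Fin d.num), (∏ i ∈ s, T i ^ m i) ∈ d'.fil (∑ i ∈ s, m i * d.wt i) := by
    intro s
    induction s using Finset.induction_on with
    | empty => simpa using C_mem_fil d' _ 1
    | insert i s hi ih =>
      rw [Finset.prod_insert hi, Finset.sum_insert hi]; exact mul_mem_fil (hpow i _) ih
  have h := this Finset.univ
  rwa [show Finsupp.weight d.wt m = ∑ i, m i * d.wt i by
    rw [Finsupp.weight_apply, Finsupp.sum_fintype _ _ (by simp)]; simp]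

theorem aeval_mem_fil {d d' : Rank} {T : Fin d.num → d'.Alg}
    (hT : ∀ i, T i ∈ d'.fil (d.wt i)) {n : ℕ} {p : d.Alg} (hp : p ∈ d.fil n) :
    MvPolynomial.aeval T p ∈ d'.fil n := by
  rw [MvPolynomial.aeval_def, MvPolynomial.eval₂_eq']
  refine Submodule.sum_mem _ fun m hm => ?_
  rw [← Algebra.smul_def]
  exact Submodule.smul_mem _ _ (fil_mono (mem_fil.1 hp m hm) (prod_pow_mem_fil hT m))

theorem eval_aeval {d d' : Rank} (T : Fin d.num → d'.Alg) (y : d'.Space) (p : d.Alg) :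
    MvPolynomial.eval y (MvPolynomial.aeval T p) =
      MvPolynomial.eval (fun i => MvPolynomial.eval y (T i)) p := by
  induction p using MvPolynomial.induction_on with
  | C a => simp
  | add p q hp hq => rw [map_add, map_add, map_add, hp, hq]
  | mul_X p i hp => rw [map_mul, map_mul, map_mul, hp, MvPolynomial.aeval_X, MvPolynomial.eval_X]

theorem finite_weight_le (d : Rank) (n : ℕ) :
    {m : Fin d.num →₀ ℕ | Finsupp.weight d.wt m ≤ n}.Finite :=
  Finsupp.finite_of_nat_weight_le d.wt (fun i => (d.pos i).ne') n

end Rank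

/-- A family of polynomials over `U` whose coefficients depend smoothly on the base point. -/
def SmoothFamily {M : SmoothMfd.{u}} (U : Set M) {d : Rank} (P : M → d.Alg) : Prop :=
  ∀ m : Fin d.num →₀ ℕ,
    ContMDiffOn (𝓡 M.dim) 𝓘(ℝ, ℝ) ∞ (fun x => MvPolynomial.coeff m (P x)) U

section SmoothFamily

variable {M : SmoothMfd.{u}} {U : Set M} {d d' : Rank}

theorem SmoothFamily.mono {V : Set M} {P : M → d.Alg} (h : SmoothFamily U P) (hV : V ⊆ U) :
    SmoothFamily V P := fun m => (h m).mono hV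

theorem SmoothFamily.congr {P Q : M → d.Alg} (h : SmoothFamily U P) (hPQ : ∀ x ∈ U, Q x = P x) :
    SmoothFamily U Q := fun m => (h m).congr fun x hx => by rw [hPQ x hx]

theorem smoothFamily_const (p : d.Alg) : SmoothFamily U (fun _ => p) :=
  fun _ => contMDiffOn_const

theorem SmoothFamily.mul {P Q : M → d.Alg} (hP : SmoothFamily U P) (hQ : SmoothFamily U Q) :
    SmoothFamily U (fun x => P x * Q x) := by
  classical
  intro m
  simp only [MvPolynomial.coeff_mul]
  exact contMDiffOn_finsetSum fun a _ => (hP a.1).mul (hQ a.2)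

theorem SmoothFamily.sum {ι : Type*} {s : Finset ι} {P : ι → M → d.Alg}
    (h : ∀ i ∈ s, SmoothFamily U (P i)) : SmoothFamily U (fun x => ∑ i ∈ s, P i x) := by
  intro m
  simp only [MvPolynomial.coeff_sum]
  exact contMDiffOn_finsetSum fun i hi => h i hi m

theorem SmoothFamily.pow {P : M → d.Alg} (h : SmoothFamily U P) (k : ℕ) :
    SmoothFamily U (fun x => P x ^ k) := by
  induction k with
  | zero => simpa using smoothFamily_const (1 : d.Alg)
  | succ k ih => simpa only [pow_succ] using ih.mul h

theorem SmoothFamily.prod {ι : Type*} {s : Finset ι} {P : ι → M → d.Alg}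
    (h : ∀ i ∈ s, SmoothFamily U (P i)) : SmoothFamily U (fun x => ∏ i ∈ s, P i x) := by
  classical
  induction s using Finset.induction_on with
  | empty => simpa using smoothFamily_const (1 : d.Alg)
  | insert i s hi ih =>
    simp only [Finset.prod_insert hi]
    exact (h i (by simp)).mul (ih fun j hj => h j (by simp [hj]))

theorem SmoothFamily.C {c : M → ℝ} (hc : ContMDiffOn (𝓡 M.dim) 𝓘(ℝ, ℝ) ∞ c U) :
    SmoothFamily U (fun x => (MvPolynomial.C (c x) : d.Alg)) := by
  classical
  intro m
  by_cases h : 0 = m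
  · simpa [MvPolynomial.coeff_C, h] using hc
  · simpa [MvPolynomial.coeff_C, h] using contMDiffOn_const

/-- Substituting smooth families into a smooth family of bounded degree. -/
theorem SmoothFamily.aeval {n : ℕ} {P : M → d.Alg} {T : M → Fin d.num → d'.Alg}
    (hP : SmoothFamily U P) (hn : ∀ x ∈ U, P x ∈ d.fil n)
    (hT : ∀ i, SmoothFamily U (fun x => T x i)) :
    SmoothFamily U (fun x => MvPolynomial.aeval (T x) (P x)) := by
  classical
  have key : SmoothFamily U (fun x => ∑ m ∈ (d.finite_weight_le n).toFinset,
      (MvPolynomial.C (MvPolynomial.coeff m (P x)) : d'.Alg) * ∏ i, T x i ^ m i) :=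
    SmoothFamily.sum fun m _ =>
      (SmoothFamily.C (hP m)).mul (SmoothFamily.prod fun i _ => (hT i).pow _)
  refine key.congr fun x hx => ?_
  rw [MvPolynomial.aeval_def, MvPolynomial.eval₂_eq']
  refine Finset.sum_subset_zero_on_sdiff (fun m hm => ?_) (fun m hm => ?_) (fun m _ => rfl)
  · simpa using Rank.mem_fil.1 (hn x hx) m hm
  · have := (Finset.mem_sdiff.1 hm).2
    rw [MvPolynomial.notMem_support_iff] at this
    simp [this]

theorem SmoothFamily.comp {N : SmoothMfd.{u}} {V : Set N} {P : N → d.Alg} {φ : M → N}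
    (hP : SmoothFamily V P) (hφ : ContMDiff (𝓡 M.dim) (𝓡 N.dim) ∞ φ) (hU : Set.MapsTo φ U V) :
    SmoothFamily U (fun x => P (φ x)) :=
  fun m => (hP m).comp (hφ.contMDiffOn) hU

theorem smoothFamily_of_locally {P : M → d.Alg}
    (h : ∀ x ∈ U, ∃ V : Set M, IsOpen V ∧ x ∈ V ∧ SmoothFamily (U ∩ V) P) : SmoothFamily U P :=
  fun m => contMDiffOn_of_locally_contMDiffOn fun x hx =>
    let ⟨V, hV, hxV, hs⟩ := h x hx
    ⟨V, hV, hxV, hs m⟩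

end SmoothFamily

/-! ### Filtered bundles -/

/-- A fibrewise map `ℝ^d → ℝ^d'` depending on `x ∈ U`, whose component of weight `w` is, over `U`,
a weighted polynomial of degree at most `w` with coefficients smooth in `x`. -/
def IsFiltered {M : SmoothMfd.{u}} (U : Set M) (d d' : Rank) (g : M → d.Space → d'.Space) : Prop :=
  ∃ T : M → Fin d'.num → d.Alg, (∀ i, SmoothFamily U fun x => T x i) ∧
    ∀ x ∈ U, ∀ i, T x i ∈ d.fil (d'.wt i) ∧ ∀ y, g x y i = MvPolynomial.eval y (T x i)

section IsFiltered

variable {M : SmoothMfd.{u}} {U : Set M} {d d' d'' : Rank}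

theorem IsFiltered.mono {V : Set M} {g : M → d.Space → d'.Space} (h : IsFiltered U d d' g)
    (hV : V ⊆ U) : IsFiltered V d d' g :=
  let ⟨T, h1, h2⟩ := h
  ⟨T, fun i => (h1 i).mono hV, fun x hx => h2 x (hV hx)⟩

theorem IsFiltered.congr {g g' : M → d.Space → d'.Space} (h : IsFiltered U d d' g)
    (hg : ∀ x ∈ U, ∀ y, g' x y = g x y) : IsFiltered U d d' g' :=
  let ⟨T, h1, h2⟩ := h
  ⟨T, h1, fun x hx i => ⟨(h2 x hx i).1, fun y => by rw [hg x hx y, (h2 x hx i).2 y]⟩⟩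

theorem IsFiltered.comp {N : SmoothMfd.{u}} {V : Set N} {g : N → d'.Space → d''.Space}
    {f : M → d.Space → d'.Space} {φ : M → N} (hg : IsFiltered V d' d'' g)
    (hf : IsFiltered U d d' f) (hφ : ContMDiff (𝓡 M.dim) (𝓡 N.dim) ∞ φ)
    (hU : Set.MapsTo φ U V) : IsFiltered U d d'' fun x y => g (φ x) (f x y) := by
  obtain ⟨S, hS1, hS2⟩ := hg
  obtain ⟨T, hT1, hT2⟩ := hf
  refine ⟨fun x i => MvPolynomial.aeval (T x) (S (φ x) i), fun i => ?_, fun x hx i => ⟨?_, ?_⟩⟩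
  · exact ((hS1 i).comp hφ hU).aeval (fun x hx => (hS2 _ (hU hx) i).1) hT1
  · exact Rank.aeval_mem_fil (fun j => (hT2 x hx j).1) (hS2 _ (hU hx) i).1
  · intro y
    change g (φ x) (f x y) i = _
    rw [(hS2 _ (hU hx) i).2, Rank.eval_aeval]
    congr 2
    funext j
    exact (hT2 x hx j).2 y

theorem isFiltered_of_locally {g : M → d.Space → d'.Space}
    (h : ∀ x ∈ U, ∃ V : Set M, IsOpen V ∧ x ∈ V ∧ IsFiltered (U ∩ V) d d' g) :
    IsFiltered U d d' g := by
  classical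
  have hex : ∀ x ∈ U, ∃ T : Fin d'.num → d.Alg, ∀ i, T i ∈ d.fil (d'.wt i) ∧
      ∀ y, g x y i = MvPolynomial.eval y (T i) := fun x hx => by
    obtain ⟨V, -, hxV, T, -, hT⟩ := h x hx
    exact ⟨T x, hT x ⟨hx, hxV⟩⟩
  choose! T hT using hex
  refine ⟨T, fun i => smoothFamily_of_locally fun x hx => ?_, hT⟩
  obtain ⟨V, hV, hxV, S, hS1, hS2⟩ := h x hx
  refine ⟨V, hV, hxV, (hS1 i).congr fun z hz => ?_⟩
  refine MvPolynomial.funext fun y => ?_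
  rw [← (hT z hz.1 i).2, ← (hS2 z hz i).2]

end IsFiltered

open Bundle in
/-- A filtered bundle: a locally trivial bundle with typical fibre `ℝ^d`, the coordinates of
`ℝ^d` carrying positive weights, and transition functions whose components of weight `w` are
weighted polynomials of degree at most `w` in the fibre coordinates, with coefficients that are
smooth on the base. The smooth structure of the total space is the one given by the charts
`(x, X)` which the trivializations induce. -/
structure FilB where
  base : SmoothMfd.{u}
  rank : Rank
  fib : base → Type u
  [topTot : TopologicalSpace (TotalSpace rank.Space fib)]
  [topFib : ∀ x, TopologicalSpace (fib x)]
  [bundle : FiberBundle rank.Space fib]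
  filtered : ∀ e ∈ trivializationAtlas rank.Space fib, ∀ e' ∈ trivializationAtlas rank.Space fib,
    IsFiltered (e.baseSet ∩ e'.baseSet) rank rank (e.coordChange e')

namespace FilB

attribute [instance] FilB.topTot FilB.topFib FilB.bundle

/-- The total space. -/
abbrev Tot (F : FilB.{u}) : Type u := Bundle.TotalSpace F.rank.Space F.fib

/-- Local trivializations. -/
abbrev Triv (F : FilB.{u}) : Type u :=
  Bundle.Trivialization F.rank.Space (Bundle.TotalSpace.proj : F.Tot → F.base)

/-- The adapted local trivializations. -/
abbrev atlas (F : FilB.{u}) : Set F.Triv :=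
  FiberBundle.trivializationAtlas F.rank.Space F.fib

/-- Over each point the adapted trivializations contain one defined there. -/
theorem exists_triv (F : FilB.{u}) (x : F.base) : ∃ e ∈ F.atlas, x ∈ e.baseSet :=
  ⟨_, FiberBundle.trivialization_mem_atlas F.rank.Space F.fib x,
    FiberBundle.mem_baseSet_trivializationAt F.rank.Space F.fib x⟩

/-- A morphism of filtered bundles: a map of bundles over a smooth map of the bases which in
adapted coordinates pulls a fibre coordinate of weight `w` back to a weighted polynomial of degree
at most `w` with coefficients that are smooth on the base. -/
structure Hom (F G : FilB.{u}) where
  base : F.base → G.base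
  smooth : ContMDiff (𝓡 F.base.dim) (𝓡 G.base.dim) ∞ base
  fib : ∀ x, F.fib x → G.fib (base x)
  filtered : ∀ e ∈ F.atlas, ∀ e' ∈ G.atlas,
    IsFiltered (e.baseSet ∩ base ⁻¹' e'.baseSet) F.rank G.rank fun x y =>
      (e' ⟨base (e.invFun (x, y)).1, fib _ (e.invFun (x, y)).2⟩).2

/-- The map of total spaces. -/
def Hom.tot {F G : FilB.{u}} (φ : Hom F G) (p : F.Tot) : G.Tot := ⟨φ.base p.1, φ.fib p.1 p.2⟩

variable {F G H : FilB.{u}}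

theorem invFun_fst {e : F.Triv}
    {x : F.base} (hx : x ∈ e.baseSet) (y : F.rank.Space) : (e.invFun (x, y)).1 = x :=
  e.proj_symm_apply' hx

theorem apply_invFun {e : F.Triv}
    {x : F.base} (hx : x ∈ e.baseSet) (y : F.rank.Space) : e (e.invFun (x, y)) = (x, y) :=
  e.apply_symm_apply' hx

theorem invFun_apply {e : F.Triv}
    {p : F.Tot} (hx : p.1 ∈ e.baseSet) : e.invFun (p.1, (e p).2) = p :=
  e.symm_apply_mk_proj (e.mem_source.2 hx)

/-- The identity morphism. -/
def Hom.id (F : FilB.{u}) : Hom F F where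
  base := _root_.id
  smooth := contMDiff_id
  fib := fun _ p => p
  filtered := fun e he e' he' => F.filtered e he e' he'

/-- Composition of morphisms. -/
def Hom.comp (φ : Hom F G) (ψ : Hom G H) : Hom F H where
  base := ψ.base ∘ φ.base
  smooth := ψ.smooth.comp φ.smooth
  fib := fun x p => ψ.fib _ (φ.fib x p)
  filtered := by
    intro e he e'' he''
    refine isFiltered_of_locally fun x _ => ?_
    obtain ⟨e', he', hxe'⟩ := G.exists_triv (φ.base x)
    refine ⟨φ.base ⁻¹' e'.baseSet, e'.open_baseSet.preimage φ.smooth.continuous, hxe', ?_⟩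
    have h1 := (φ.filtered e he e' he').mono
      (V := (e.baseSet ∩ (ψ.base ∘ φ.base) ⁻¹' e''.baseSet) ∩ φ.base ⁻¹' e'.baseSet)
      fun z hz => ⟨hz.1.1, hz.2⟩
    refine ((ψ.filtered e' he' e'' he'').comp h1 φ.smooth fun z hz => ⟨hz.2, hz.1.2⟩).congr ?_
    intro z hz y
    have h3 : e'.invFun (φ.base z, (e' (φ.tot (e.invFun (z, y)))).2) = φ.tot (e.invFun (z, y)) := by
      have h4 : (φ.tot (e.invFun (z, y))).1 = φ.base z := congrArg φ.base (invFun_fst hz.1.1 y)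
      have := invFun_apply (F := G) (e := e') (p := φ.tot (e.invFun (z, y)))
        (by rw [h4]; exact hz.2)
      rwa [h4] at this
    change (e'' (ψ.tot (φ.tot (e.invFun (z, y))))).2 =
      (e'' (ψ.tot (e'.invFun (φ.base z, (e' (φ.tot (e.invFun (z, y)))).2)))).2
    rw [h3]

/-- The category of filtered bundles. -/
instance : CategoryTheory.Category FilB.{u} where
  Hom := Hom
  id := Hom.id
  comp := Hom.comp

end FilB

/-! ### Filtered polynomial algebra bundles -/

/-- A family of algebra homomorphisms `𝒜(ℝ^d) → 𝒜(ℝ^d')` over `U` that is smooth: the images of the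
generators have smooth coefficients. -/
def IsSmoothAlg {M : SmoothMfd.{u}} (U : Set M) (d d' : Rank)
    (g : ∀ x ∈ U, d.Alg →ₐ[ℝ] d'.Alg) : Prop :=
  ∃ T : M → Fin d.num → d'.Alg, (∀ i, SmoothFamily U fun x => T x i) ∧
    ∀ x hx i, g x hx (MvPolynomial.X i) = T x i

section IsSmoothAlg

variable {M : SmoothMfd.{u}} {U : Set M} {d d' d'' : Rank}

theorem IsSmoothAlg.mono {V : Set M} {g : ∀ x ∈ U, d.Alg →ₐ[ℝ] d'.Alg}
    (h : IsSmoothAlg U d d' g) (hV : V ⊆ U) : IsSmoothAlg V d d' fun x hx => g x (hV hx) :=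
  let ⟨T, h1, h2⟩ := h
  ⟨T, fun i => (h1 i).mono hV, fun x hx => h2 x (hV hx)⟩

theorem IsSmoothAlg.congr {g g' : ∀ x ∈ U, d.Alg →ₐ[ℝ] d'.Alg} (h : IsSmoothAlg U d d' g)
    (hg : ∀ x hx, g' x hx = g x hx) : IsSmoothAlg U d d' g' := by
  rwa [show g' = g from funext fun x => funext fun hx => hg x hx]

theorem IsSmoothAlg.comp {N : SmoothMfd.{u}} {V : Set N} {g : ∀ x ∈ V, d.Alg →ₐ[ℝ] d'.Alg}
    {f : ∀ x ∈ U, d'.Alg →ₐ[ℝ] d''.Alg} {φ : M → N} (hg : IsSmoothAlg V d d' g)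
    (hgf : ∀ x hx i, g x hx (MvPolynomial.X i) ∈ d'.fil (d.wt i))
    (hf : IsSmoothAlg U d' d'' f) (hφ : ContMDiff (𝓡 M.dim) (𝓡 N.dim) ∞ φ)
    (hU : Set.MapsTo φ U V) :
    IsSmoothAlg U d d'' fun x hx => (f x hx).comp (g (φ x) (hU hx)) := by
  obtain ⟨S, hS1, hS2⟩ := hg
  obtain ⟨T, hT1, hT2⟩ := hf
  refine ⟨fun x i => MvPolynomial.aeval (T x) (S (φ x) i), fun i => ?_, fun x hx i => ?_⟩
  · exact ((hS1 i).comp hφ hU).aeval (fun x hx => hS2 _ (hU hx) i ▸ hgf _ (hU hx) i) hT1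
  · have : f x hx = MvPolynomial.aeval (T x) := by
      refine MvPolynomial.algHom_ext fun j => ?_
      rw [hT2 x hx j, MvPolynomial.aeval_X]
    change f x hx (g (φ x) (hU hx) (MvPolynomial.X i)) = _
    rw [hS2, this]

theorem isSmoothAlg_of_locally {g : ∀ x ∈ U, d.Alg →ₐ[ℝ] d'.Alg}
    (h : ∀ x ∈ U, ∃ V : Set M, IsOpen V ∧ x ∈ V ∧
      IsSmoothAlg (U ∩ V) d d' fun x hx => g x hx.1) : IsSmoothAlg U d d' g := by
  classical
  refine ⟨fun x i => if hx : x ∈ U then g x hx (MvPolynomial.X i) else 0, fun i => ?_, fun x hx i => by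
    simp [hx]⟩
  refine smoothFamily_of_locally fun x hx => ?_
  obtain ⟨V, hV, hxV, T, h1, h2⟩ := h x hx
  refine ⟨V, hV, hxV, (h1 i).congr fun z hz => ?_⟩
  change dite _ _ _ = _
  rw [dif_pos hz.1]
  exact h2 z hz i

end IsSmoothAlg

/-- A local trivialization, over an open set, of a family of filtered algebras: fibrewise
isomorphisms of filtered algebras onto `𝒜(ℝ^d)`. -/
structure AlgTriv (M : SmoothMfd.{u}) (d : Rank) (A : M → Type u) [∀ x, CommRing (A x)]
    [∀ x, Algebra ℝ (A x)] (fil : ∀ x, ℕ → Submodule ℝ (A x)) where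
  baseSet : Set M
  open_baseSet : IsOpen baseSet
  iso : ∀ x ∈ baseSet, A x ≃ₐ[ℝ] d.Alg
  mem_fil : ∀ x hx n a, a ∈ fil x n ↔ iso x hx a ∈ d.fil n

/-- A filtered polynomial algebra bundle: a locally trivial bundle of filtered algebras with
typical fibre `𝒜(ℝ^d)`, whose transition functions are automorphisms of the filtered algebra
`𝒜(ℝ^d)` depending smoothly on the base point. -/
structure FPAB where
  base : SmoothMfd.{u}
  rank : Rank
  fib : base → Type u
  [ring : ∀ x, CommRing (fib x)]
  [alg : ∀ x, Algebra ℝ (fib x)]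
  fil : ∀ x, ℕ → Submodule ℝ (fib x)
  atlas : Set (AlgTriv base rank fib fil)
  exists_triv : ∀ x, ∃ e ∈ atlas, x ∈ e.baseSet
  smooth : ∀ e ∈ atlas, ∀ e' ∈ atlas, IsSmoothAlg (e.baseSet ∩ e'.baseSet) rank rank fun x hx =>
    (e'.iso x hx.2).toAlgHom.comp (e.iso x hx.1).symm.toAlgHom

namespace FPAB

attribute [instance] FPAB.ring FPAB.alg

/-- A morphism `A → B` of filtered polynomial algebra bundles: a smooth map `φ` from the base of
`B` to the base of `A` (algebra bundles being contravariant in the base) together with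
homomorphisms of filtered algebras from the fibre of `A` over `φ x` to the fibre of `B` over `x`
depending smoothly on `x`. -/
structure Hom (A B : FPAB.{u}) where
  base : B.base → A.base
  smooth_base : ContMDiff (𝓡 B.base.dim) (𝓡 A.base.dim) ∞ base
  fib : ∀ x, A.fib (base x) →ₐ[ℝ] B.fib x
  map_fil : ∀ x n a, a ∈ A.fil (base x) n → fib x a ∈ B.fil x n
  smooth : ∀ e ∈ A.atlas, ∀ e' ∈ B.atlas,
    IsSmoothAlg (e'.baseSet ∩ base ⁻¹' e.baseSet) A.rank B.rank fun x hx =>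
      ((e'.iso x hx.1).toAlgHom.comp (fib x)).comp (e.iso (base x) hx.2).symm.toAlgHom

variable {A B C : FPAB.{u}}

/-- The identity morphism. -/
def Hom.id (A : FPAB.{u}) : Hom A A where
  base := _root_.id
  smooth_base := contMDiff_id
  fib := fun x => AlgHom.id ℝ (A.fib x)
  map_fil := fun _ _ _ h => h
  smooth := fun e he e' he' => ((A.smooth e he e' he').mono
    (V := e'.baseSet ∩ _root_.id ⁻¹' e.baseSet) fun _ hx => ⟨hx.2, hx.1⟩).congr fun _ _ => rfl

theorem symm_mem_fil (e : AlgTriv A.base A.rank A.fib A.fil) {x : A.base} (hx : x ∈ e.baseSet)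
    {n : ℕ} {p : A.rank.Alg} (hp : p ∈ A.rank.fil n) : (e.iso x hx).symm p ∈ A.fil x n := by
  rw [e.mem_fil x hx, AlgEquiv.apply_symm_apply]
  exact hp

/-- Composition of morphisms. -/
def Hom.comp (α : Hom A B) (β : Hom B C) : Hom A C where
  base := α.base ∘ β.base
  smooth_base := α.smooth_base.comp β.smooth_base
  fib := fun x => (β.fib x).comp (α.fib (β.base x))
  map_fil := fun x n a h => β.map_fil x n _ (α.map_fil (β.base x) n a h)
  smooth := by
    intro e he e'' he''
    refine isSmoothAlg_of_locally fun x _ => ?_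
    obtain ⟨e', he', hxe'⟩ := B.exists_triv (β.base x)
    refine ⟨β.base ⁻¹' e'.baseSet, e'.open_baseSet.preimage β.smooth_base.continuous, hxe', ?_⟩
    have h1 := (β.smooth e' he' e'' he'').mono
      (V := (e''.baseSet ∩ (α.base ∘ β.base) ⁻¹' e.baseSet) ∩ β.base ⁻¹' e'.baseSet)
      fun z hz => ⟨hz.1.1, hz.2⟩
    refine ((α.smooth e he e' he').comp (fun z hz i => ?_) h1 β.smooth_base
      fun z hz => ⟨hz.2, hz.1.2⟩).congr ?_
    · exact (e'.mem_fil z hz.1 _ _).1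
        (α.map_fil z _ _ (symm_mem_fil e hz.2 (A.rank.X_mem_fil i)))
    · intro z hz
      refine AlgHom.ext fun p => ?_
      simp

/-- The category of filtered polynomial algebra bundles. -/
instance : CategoryTheory.Category FPAB.{u} where
  Hom := Hom
  id := Hom.id
  comp := Hom.comp

end FPAB

/-! ### The dual of a filtered bundle -/

/-- The filtered algebra `𝔸 = ℝ[ε]` of polynomials on `ℝ`; `ε ^ k` has weight `k` and
the filtration is the one by degree. -/
abbrev AA : Type := Polynomial ℝ

namespace FilB

variable {F G H : FilB.{u}}

/-- The fibre coordinates of a point in a local trivialization. -/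
abbrev coord (F : FilB.{u}) (e : F.Triv) {x : F.base} (p : F.fib x) : F.rank.Space := (e ⟨x, p⟩).2

/-- Functions on a fibre that are, in adapted coordinates, weighted polynomials of degree
at most `n`. -/
def IsPolyFn (F : FilB.{u}) (x : F.base) (n : ℕ) (g : F.fib x → ℝ) : Prop :=
  ∀ e ∈ F.atlas, x ∈ e.baseSet → ∃ P ∈ F.rank.fil n, ∀ p, g p = MvPolynomial.eval (F.coord e p) P

theorem exists_transition {e e' : F.Triv} (he : e ∈ F.atlas) (he' : e' ∈ F.atlas) {x : F.base}
    (hx : x ∈ e.baseSet) (hx' : x ∈ e'.baseSet) :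
    ∃ T : Fin F.rank.num → F.rank.Alg, (∀ i, T i ∈ F.rank.fil (F.rank.wt i)) ∧
      ∀ p : F.fib x, F.coord e' p = fun i => MvPolynomial.eval (F.coord e p) (T i) := by
  obtain ⟨T, -, hT⟩ := F.filtered e he e' he'
  refine ⟨T x, fun i => (hT x ⟨hx, hx'⟩ i).1, fun p => funext fun i => ?_⟩
  rw [← (hT x ⟨hx, hx'⟩ i).2]
  exact congrFun (e.coordChange_apply_snd e' (p := ⟨x, p⟩) hx).symm i

theorem isPolyFn_of_chart {e : F.Triv} (he : e ∈ F.atlas) {x : F.base} (hx : x ∈ e.baseSet) {n : ℕ}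
    {g : F.fib x → ℝ} {P : F.rank.Alg} (hP : P ∈ F.rank.fil n)
    (hg : ∀ p, g p = MvPolynomial.eval (F.coord e p) P) : F.IsPolyFn x n g := by
  intro e' he' hx'
  obtain ⟨T, hT1, hT2⟩ := exists_transition he' he hx' hx
  refine ⟨MvPolynomial.aeval T P, Rank.aeval_mem_fil hT1 hP, fun p => ?_⟩
  rw [hg, hT2, Rank.eval_aeval]

theorem IsPolyFn.mono {x : F.base} {m n : ℕ} {g : F.fib x → ℝ} (hg : F.IsPolyFn x m g)
    (h : m ≤ n) : F.IsPolyFn x n g := fun e he hx =>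
  let ⟨P, hP, hPg⟩ := hg e he hx
  ⟨P, Rank.fil_mono h hP, hPg⟩

theorem isPolyFn_const (x : F.base) (n : ℕ) (c : ℝ) : F.IsPolyFn x n fun _ => c := fun _ _ _ =>
  ⟨MvPolynomial.C c, Rank.C_mem_fil _ _ _, fun p => by simp⟩

theorem IsPolyFn.mul {x : F.base} {m n : ℕ} {g h : F.fib x → ℝ} (hg : F.IsPolyFn x m g)
    (hh : F.IsPolyFn x n h) : F.IsPolyFn x (m + n) fun p => g p * h p := fun e he hx => by
  obtain ⟨P, hP, hPg⟩ := hg e he hx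
  obtain ⟨Q, hQ, hQh⟩ := hh e he hx
  exact ⟨P * Q, Rank.mul_mem_fil hP hQ, fun p => by rw [map_mul, ← hPg, ← hQh]⟩

theorem IsPolyFn.sum {ι : Type*} {s : Finset ι} {x : F.base} {n : ℕ} {g : ι → F.fib x → ℝ}
    (hg : ∀ i ∈ s, F.IsPolyFn x n (g i)) : F.IsPolyFn x n fun p => ∑ i ∈ s, g i p := by
  classical
  intro e he hx
  have : ∀ i ∈ s, ∃ P ∈ F.rank.fil n, ∀ p, g i p = MvPolynomial.eval (F.coord e p) P :=
    fun i hi => hg i hi e he hx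
  choose! P hP1 hP2 using this
  exact ⟨∑ i ∈ s, P i, Submodule.sum_mem _ hP1, fun p => by
    rw [map_sum]; exact Finset.sum_congr rfl fun i hi => hP2 i hi p⟩

/-- `Hom_f(F_x, 𝔸)`: the morphisms `f` of filtered spaces from the fibre `F_x` to `𝔸`. They take
values in some `𝔸_n`, and pull the coordinate of weight `k` on `𝔸`, the coefficient of `ε ^ k`, back
to weighted polynomials of degree at most `k`. The algebra structure is the pointwise one. -/
def homF (F : FilB.{u}) (x : F.base) : Subalgebra ℝ (F.fib x → AA) where
  carrier := {f | (∃ n, ∀ p, (f p).natDegree ≤ n) ∧ ∀ k, F.IsPolyFn x k fun p => (f p).coeff k}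
  add_mem' := by
    rintro f g ⟨⟨m, hm⟩, hf⟩ ⟨⟨n, hn⟩, hg⟩
    refine ⟨⟨max m n, fun p => (Polynomial.natDegree_add_le _ _).trans
      (max_le_max (hm p) (hn p))⟩, fun k e he hx => ?_⟩
    obtain ⟨P, hP, hPf⟩ := hf k e he hx
    obtain ⟨Q, hQ, hQg⟩ := hg k e he hx
    exact ⟨P + Q, Submodule.add_mem _ hP hQ, fun p => by
      rw [map_add, ← hPf, ← hQg]; exact Polynomial.coeff_add _ _ _⟩
  mul_mem' := by
    rintro f g ⟨⟨m, hm⟩, hf⟩ ⟨⟨n, hn⟩, hg⟩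
    refine ⟨⟨m + n, fun p => Polynomial.natDegree_mul_le.trans (add_le_add (hm p) (hn p))⟩,
      fun k => ?_⟩
    simp only [Pi.mul_apply, Polynomial.coeff_mul]
    exact IsPolyFn.sum fun ij hij =>
      ((hf ij.1).mul (hg ij.2)).mono (Finset.HasAntidiagonal.mem_antidiagonal.1 hij).le
  algebraMap_mem' := fun c =>
    ⟨⟨0, fun p => (Polynomial.natDegree_C c).le⟩, fun k => isPolyFn_const x k ((Polynomial.C c).coeff k)⟩

/-- Specialization of filtered morphisms `F_x → 𝔸` at `ε = 1`. -/
def evOne (F : FilB.{u}) (x : F.base) : F.homF x →ₐ[ℝ] (F.fib x → ℝ) :=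
  ((Polynomial.aeval (1 : ℝ)).compLeft (F.fib x)).comp (F.homF x).val

theorem evOne_apply (x : F.base) (f : F.homF x) (p : F.fib x) :
    F.evOne x f p = (f.1 p).eval 1 := by
  change Polynomial.aeval (1 : ℝ) (f.1 p) = _
  rw [Polynomial.coe_aeval_eq_eval]

/-- The fibre over `x` of the dual: the algebra of filtered morphisms `F_x → 𝔸`, two of them being
identified if they agree at `ε = 1`. Through the values at `ε = 1` (`val`, which is injective) this
is the algebra of polynomial functions on the fibre. Without the identification `Hom_f(F_x, 𝔸)` is
not the polynomial algebra but its Rees algebra, having one more generator `ε`. -/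
abbrev Dual (F : FilB.{u}) (x : F.base) : Type u := F.homF x ⧸ RingHom.ker (F.evOne x)

/-- The class of a filtered morphism. -/
abbrev mkDual (F : FilB.{u}) (x : F.base) : F.homF x →ₐ[ℝ] F.Dual x :=
  Ideal.Quotient.mkₐ ℝ (RingHom.ker (F.evOne x))

/-- The filtration of the dual: the part of index `n` consists of the classes of the
filtered morphisms `F_x → 𝔸_n`. -/
def dualFil (F : FilB.{u}) (x : F.base) (n : ℕ) : Submodule ℝ (F.Dual x) :=
  Submodule.map (F.mkDual x).toLinearMap
    { carrier := {f | ∀ p, (f.1 p).natDegree ≤ n}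
      add_mem' := fun hf hg p => (Polynomial.natDegree_add_le _ _).trans (max_le (hf p) (hg p))
      zero_mem' := fun _ => Nat.zero_le _
      smul_mem' := fun c _ hf p => (Polynomial.natDegree_smul_le c _).trans (hf p) }

/-- The function on the fibre `F_x` given by an element of the dual. -/
def val (F : FilB.{u}) (x : F.base) : F.Dual x →ₐ[ℝ] (F.fib x → ℝ) := Ideal.kerLiftAlg (F.evOne x)

theorem val_mk (x : F.base) (f : F.homF x) (p : F.fib x) :
    F.val x (F.mkDual x f) p = (f.1 p).eval 1 := evOne_apply x f p

theorem val_injective (x : F.base) : Function.Injective (F.val x) :=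
  Ideal.kerLiftAlg_injective _

/-- The filtered morphism `p ↦ X^i(p) ε ^ w` given by a coordinate `X^i` of weight `w`. -/
def coordHom {e : F.Triv} (he : e ∈ F.atlas) {x : F.base} (hx : x ∈ e.baseSet)
    (i : Fin F.rank.num) : F.homF x :=
  ⟨fun p => Polynomial.monomial (F.rank.wt i) (F.coord e p i),
    ⟨F.rank.wt i, fun _ => Polynomial.natDegree_monomial_le _⟩, fun k => by
      simp only [Polynomial.coeff_monomial]
      by_cases h : F.rank.wt i = k
      · subst h
        exact isPolyFn_of_chart he hx (F.rank.X_mem_fil i) fun p => by simp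
      · simpa [h] using isPolyFn_const x k 0⟩

/-- A weighted polynomial in adapted coordinates as a filtered morphism. -/
def polyHom {e : F.Triv} (he : e ∈ F.atlas) {x : F.base} (hx : x ∈ e.baseSet) :
    F.rank.Alg →ₐ[ℝ] F.homF x := MvPolynomial.aeval (coordHom he hx)

theorem val_polyHom {e : F.Triv} (he : e ∈ F.atlas) {x : F.base} (hx : x ∈ e.baseSet)
    (P : F.rank.Alg) (p : F.fib x) :
    F.val x (F.mkDual x (polyHom he hx P)) p = MvPolynomial.eval (F.coord e p) P := by
  have : (((Pi.evalAlgHom ℝ (fun _ => ℝ) p).comp (F.val x)).comp (F.mkDual x)).comp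
      (polyHom he hx) = MvPolynomial.aeval (F.coord e p) := by
    refine MvPolynomial.algHom_ext fun i => ?_
    change F.val x (F.mkDual x (MvPolynomial.aeval (coordHom he hx) (MvPolynomial.X i))) p = _
    rw [val_mk, MvPolynomial.aeval_X, MvPolynomial.aeval_X]
    simp [coordHom]
  exact DFunLike.congr_fun this P

theorem exists_coord_eq {e : F.Triv} {x : F.base} (hx : x ∈ e.baseSet) (y : F.rank.Space) :
    ∃ p : F.fib x, F.coord e p = y := by
  have h1 := invFun_fst (F := F) (e := e) hx y
  have h2 := apply_invFun (F := F) (e := e) hx y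
  generalize e.invFun (x, y) = q at h1 h2
  obtain ⟨x', p⟩ := q
  obtain rfl : x' = x := h1
  exact ⟨p, congrArg Prod.snd h2⟩

theorem alg_ext {e : F.Triv} {x : F.base} (hx : x ∈ e.baseSet) {P Q : F.rank.Alg}
    (h : ∀ p : F.fib x, MvPolynomial.eval (F.coord e p) P = MvPolynomial.eval (F.coord e p) Q) :
    P = Q := by
  refine MvPolynomial.funext fun y => ?_
  obtain ⟨p, rfl⟩ := exists_coord_eq hx y
  exact h p

theorem isPolyFn_val (x : F.base) {n : ℕ} {a : F.Dual x} (ha : a ∈ F.dualFil x n) :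
    F.IsPolyFn x n (F.val x a) := by
  obtain ⟨f, hf, rfl⟩ := ha
  have : F.val x ((F.mkDual x).toLinearMap f) =
      fun p => ∑ k ∈ Finset.range (n + 1), (f.1 p).coeff k := by
    funext p
    change F.val x (F.mkDual x f) p = _
    rw [val_mk, Polynomial.eval_eq_sum_range' (Nat.lt_succ_of_le (hf p))]
    simp
  rw [this]
  exact IsPolyFn.sum fun k hk => (f.2.2 k).mono (Nat.lt_succ_iff.1 (Finset.mem_range.1 hk))

theorem exists_mem_dualFil (x : F.base) (a : F.Dual x) : ∃ n, a ∈ F.dualFil x n := by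
  obtain ⟨f, rfl⟩ := Ideal.Quotient.mkₐ_surjective ℝ (RingHom.ker (F.evOne x)) a
  obtain ⟨n, hn⟩ := f.2.1
  exact ⟨n, f, hn, rfl⟩

theorem polyHom_mem {e : F.Triv} (he : e ∈ F.atlas) {x : F.base} (hx : x ∈ e.baseSet) {n : ℕ}
    {P : F.rank.Alg} (hP : P ∈ F.rank.fil n) : F.mkDual x (polyHom he hx P) ∈ F.dualFil x n := by
  refine ⟨polyHom he hx P, fun p => ?_, rfl⟩
  have : (polyHom he hx P).1 p =
      MvPolynomial.aeval (fun i => Polynomial.monomial (F.rank.wt i) (F.coord e p i)) P := by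
    have : ((Pi.evalAlgHom ℝ (fun _ => AA) p).comp (F.homF x).val).comp (polyHom he hx) =
        MvPolynomial.aeval fun i => Polynomial.monomial (F.rank.wt i) (F.coord e p i) := by
      refine MvPolynomial.algHom_ext fun i => ?_
      change (MvPolynomial.aeval (coordHom he hx) (MvPolynomial.X i)).1 p = _
      rw [MvPolynomial.aeval_X, MvPolynomial.aeval_X]
      rfl
    exact DFunLike.congr_fun this P
  rw [this, MvPolynomial.aeval_def, MvPolynomial.eval₂_eq']
  refine Polynomial.natDegree_sum_le_of_forall_le _ _ fun m hm => ?_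
  refine Polynomial.natDegree_mul_le.trans ?_
  rw [show (algebraMap ℝ (Polynomial ℝ)) = Polynomial.C from rfl, Polynomial.natDegree_C, zero_add]
  refine (Polynomial.natDegree_prod_le _ _).trans (le_trans ?_ (Rank.mem_fil.1 hP m hm))
  rw [Finsupp.weight_apply, Finsupp.sum_fintype _ _ (by simp)]
  refine Finset.sum_le_sum fun i _ => Polynomial.natDegree_pow_le.trans ?_
  exact Nat.mul_le_mul_left _ (Polynomial.natDegree_monomial_le _)

theorem polyHom_bijective {e : F.Triv} (he : e ∈ F.atlas) {x : F.base} (hx : x ∈ e.baseSet) :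
    Function.Bijective ((F.mkDual x).comp (polyHom he hx)) := by
  constructor
  · intro P Q h
    refine alg_ext hx fun p => ?_
    rw [← val_polyHom he hx, ← val_polyHom he hx]
    exact congrFun (congrArg (F.val x) h) p
  · intro a
    obtain ⟨n, hn⟩ := exists_mem_dualFil x a
    obtain ⟨P, -, hP⟩ := isPolyFn_val x hn e he hx
    exact ⟨P, val_injective x (funext fun p => (val_polyHom he hx P p).trans (hP p).symm)⟩

/-- The local trivialization of the dual given by adapted coordinates. -/
def dualTriv {e : F.Triv} (he : e ∈ F.atlas) : AlgTriv F.base F.rank F.Dual F.dualFil where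
  baseSet := e.baseSet
  open_baseSet := e.open_baseSet
  iso := fun x hx => (AlgEquiv.ofBijective _ (polyHom_bijective he hx)).symm
  mem_fil := by
    intro x hx n a
    obtain ⟨P, rfl⟩ := (AlgEquiv.ofBijective _ (polyHom_bijective he hx)).surjective a
    rw [AlgEquiv.symm_apply_apply]
    refine ⟨fun h => ?_, fun h => polyHom_mem he hx h⟩
    obtain ⟨Q, hQ, hPQ⟩ := isPolyFn_val x h e he hx
    rwa [alg_ext hx fun p => (val_polyHom he hx P p).symm.trans (hPQ p)]

theorem val_dualTriv_symm {e : F.Triv} (he : e ∈ F.atlas) {x : F.base} (hx : x ∈ e.baseSet)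
    (P : F.rank.Alg) (p : F.fib x) :
    F.val x (((dualTriv he).iso x hx).symm P) p = MvPolynomial.eval (F.coord e p) P :=
  val_polyHom he hx P p

theorem eval_dualTriv {e : F.Triv} (he : e ∈ F.atlas) {x : F.base} (hx : x ∈ e.baseSet)
    (a : F.Dual x) (p : F.fib x) :
    MvPolynomial.eval (F.coord e p) ((dualTriv he).iso x hx a) = F.val x a p := by
  rw [← val_dualTriv_symm he hx, AlgEquiv.symm_apply_apply]

/-- Composition of filtered morphisms `G_{φ(x)} → 𝔸` with a morphism `φ : F → G`. -/
def pull (φ : Hom F G) (x : F.base) : G.homF (φ.base x) →ₐ[ℝ] F.homF x :=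
  AlgHom.codRestrict
    (AlgHom.pi fun p =>
      (Pi.evalAlgHom ℝ (fun _ => AA) (φ.fib x p)).comp (G.homF (φ.base x)).val) (F.homF x) (by
    rintro ⟨f, ⟨n, hn⟩, hf⟩
    refine ⟨⟨n, fun p => hn _⟩, fun k => ?_⟩
    obtain ⟨e, he, hx⟩ := F.exists_triv x
    obtain ⟨e', he', hx'⟩ := G.exists_triv (φ.base x)
    obtain ⟨P, hP, hPf⟩ := hf k e' he' hx'
    obtain ⟨T, -, hT⟩ := φ.filtered e he e' he'
    refine isPolyFn_of_chart he hx (P := MvPolynomial.aeval (T x) P)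
      (Rank.aeval_mem_fil (fun i => (hT x ⟨hx, hx'⟩ i).1) hP) fun p => ?_
    rw [Rank.eval_aeval]
    refine (hPf _).trans ?_
    congr 2
    funext i
    rw [← (hT x ⟨hx, hx'⟩ i).2]
    have := invFun_apply (e := e) (p := (⟨x, p⟩ : F.Tot)) hx
    change (e' (φ.tot ⟨x, p⟩)).2 i = (e' (φ.tot (e.invFun (x, (e ⟨x, p⟩).2)))).2 i
    rw [this])

theorem pull_apply (φ : Hom F G) (x : F.base) (f : G.homF (φ.base x)) (p : F.fib x) :
    (pull φ x f).1 p = f.1 (φ.fib x p) := rfl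

/-- The homomorphism of duals induced by a morphism of filtered bundles. -/
def dualMap (φ : Hom F G) (x : F.base) : G.Dual (φ.base x) →ₐ[ℝ] F.Dual x :=
  Ideal.Quotient.liftₐ (RingHom.ker (G.evOne (φ.base x))) ((F.mkDual x).comp (pull φ x)) (by
    intro f hf
    refine Ideal.Quotient.eq_zero_iff_mem.2 ?_
    rw [RingHom.mem_ker] at hf ⊢
    funext p
    have := congrFun hf (φ.fib x p)
    rw [evOne_apply] at this ⊢
    exact this)

theorem dualMap_mk (φ : Hom F G) (x : F.base) (f : G.homF (φ.base x)) :
    dualMap φ x (G.mkDual (φ.base x) f) = F.mkDual x (pull φ x f) := rfl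

theorem val_dualMap (φ : Hom F G) (x : F.base) (a : G.Dual (φ.base x)) (p : F.fib x) :
    F.val x (dualMap φ x a) p = G.val (φ.base x) a (φ.fib x p) := by
  obtain ⟨f, rfl⟩ := Ideal.Quotient.mkₐ_surjective ℝ (RingHom.ker (G.evOne _)) a
  change F.val x (dualMap φ x (G.mkDual (φ.base x) f)) p = G.val _ (G.mkDual (φ.base x) f) _
  rw [dualMap_mk, val_mk, val_mk, pull_apply]

theorem isSmoothAlg_dualMap (φ : Hom F G) {e : F.Triv} (he : e ∈ F.atlas) {e' : G.Triv}
    (he' : e' ∈ G.atlas) :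
    IsSmoothAlg (e.baseSet ∩ φ.base ⁻¹' e'.baseSet) G.rank F.rank fun x hx =>
      (((dualTriv he).iso x hx.1).toAlgHom.comp (dualMap φ x)).comp
        ((dualTriv he').iso (φ.base x) hx.2).symm.toAlgHom := by
  obtain ⟨T, hT1, hT2⟩ := φ.filtered e he e' he'
  refine ⟨T, hT1, fun x hx i => alg_ext hx.1 fun p => ?_⟩
  change MvPolynomial.eval (F.coord e p) ((dualTriv he).iso x hx.1
    (dualMap φ x (((dualTriv he').iso (φ.base x) hx.2).symm (MvPolynomial.X i)))) = _
  rw [eval_dualTriv, val_dualMap, val_dualTriv_symm, MvPolynomial.eval_X, ← (hT2 x hx i).2]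
  have := invFun_apply (e := e) (p := (⟨x, p⟩ : F.Tot)) hx.1
  change (e' (φ.tot ⟨x, p⟩)).2 i = (e' (φ.tot (e.invFun (x, (e ⟨x, p⟩).2)))).2 i
  rw [this]

theorem dualMap_id (x : F.base) (a : F.Dual x) : dualMap (Hom.id F) x a = a := by
  refine val_injective x (funext fun p => ?_)
  exact val_dualMap (Hom.id F) x a p

/-- The filtered polynomial algebra bundle dual to a filtered bundle. -/
abbrev dual (F : FilB.{u}) : FPAB.{u} where
  base := F.base
  rank := F.rank
  fib := F.Dual
  fil := F.dualFil
  atlas := {t | ∃ (e : F.Triv) (he : e ∈ F.atlas), t = dualTriv he}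
  exists_triv := fun x =>
    let ⟨e, he, hx⟩ := F.exists_triv x
    ⟨dualTriv he, ⟨e, he, rfl⟩, hx⟩
  smooth := by
    rintro _ ⟨e, he, rfl⟩ _ ⟨e', he', rfl⟩
    refine ((isSmoothAlg_dualMap (Hom.id F) he' he).mono
      (V := e.baseSet ∩ e'.baseSet) fun x hx => ⟨hx.2, hx.1⟩).congr fun x hx => ?_
    refine AlgHom.ext fun P => ?_
    exact congrArg (fun a => (dualTriv he').iso x hx.2 a) (dualMap_id x _).symm

/-- The morphism of duals induced by a morphism of filtered bundles. -/
def dualHom (φ : Hom F G) : FPAB.Hom G.dual F.dual where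
  base := φ.base
  smooth_base := φ.smooth
  fib := dualMap φ
  map_fil := by
    rintro x n _ ⟨f, hf, rfl⟩
    exact ⟨pull φ x f, fun p => hf _, rfl⟩
  smooth := by
    rintro _ ⟨e', he', rfl⟩ _ ⟨e, he, rfl⟩
    exact isSmoothAlg_dualMap φ he he'

theorem dualHom_id (F : FilB.{u}) : dualHom (Hom.id F) = FPAB.Hom.id F.dual := by
  have : dualMap (Hom.id F) = fun x => AlgHom.id ℝ (F.Dual x) :=
    funext fun x => AlgHom.ext fun a => dualMap_id x a
  simp only [dualHom, FPAB.Hom.id]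
  congr 1

theorem dualHom_comp (φ : Hom F G) (ψ : Hom G H) :
    dualHom (φ.comp ψ) = (dualHom ψ).comp (dualHom φ) := by
  have : dualMap (φ.comp ψ) = fun x => (dualMap φ x).comp (dualMap ψ (φ.base x)) :=
    funext fun x => AlgHom.ext fun a => by
      obtain ⟨f, rfl⟩ := Ideal.Quotient.mkₐ_surjective ℝ (RingHom.ker (H.evOne _)) a
      rfl
  simp only [dualHom, FPAB.Hom.comp]
  congr 1

/-- The functor `F ↦ Hom_f(F, 𝔸)`; on morphisms it is composition with the morphism. -/
def dualFunctor : CategoryTheory.Functor FilB.{u}ᵒᵖ FPAB.{u} where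
  obj F := F.unop.dual
  map φ := dualHom φ.unop
  map_id F := dualHom_id F.unop
  map_comp φ ψ := dualHom_comp ψ.unop φ.unop

end FilB

/-! ### The filtered bundle reconstructed from a filtered polynomial algebra bundle -/

namespace FPAB

variable {A B C : FPAB.{u}}

/-- `Hom_{f-alg}(A_x, 𝔸)`: the homomorphisms of filtered algebras from the fibre `A_x` to `𝔸`. -/
def HomFAlg (A : FPAB.{u}) (x : A.base) : Type u :=
  {h : A.fib x →ₐ[ℝ] AA // ∀ n, ∀ a ∈ A.fil x n, (h a).natDegree ≤ n}

/-- Two homomorphisms into `𝔸` are identified if they agree at `ε = 1`. -/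
instance specSetoid (A : FPAB.{u}) (x : A.base) : Setoid (A.HomFAlg x) where
  r h h' := ∀ a, (h.1 a).eval 1 = (h'.1 a).eval 1
  iseqv := ⟨fun _ _ => rfl, fun h a => (h a).symm, fun h h' a => (h a).trans (h' a)⟩

/-- The fibre over `x` of the reconstructed bundle: the filtered algebra homomorphisms `A_x → 𝔸`,
two of them being identified if they agree at `ε = 1`. Through the values at `ε = 1` (`ev`, which is
injective) these are the characters of `A_x`, that is, the evaluations at points. Without the
identification a generator of weight `w` could go to any polynomial of degree at most `w`. -/
def Spec (A : FPAB.{u}) (x : A.base) : Type u := Quotient (A.specSetoid x)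

/-- The value at `ε = 1`. -/
def ev (A : FPAB.{u}) (x : A.base) (s : A.Spec x) : A.fib x →ₐ[ℝ] ℝ :=
  Quotient.lift (fun h : A.HomFAlg x => (Polynomial.aeval (1 : ℝ)).comp h.1)
    (fun h h' hh => AlgHom.ext fun a => by
      have := hh a
      simpa [Polynomial.coe_aeval_eq_eval] using this) s

theorem ev_mk (x : A.base) (h : A.HomFAlg x) (a : A.fib x) :
    A.ev x (Quotient.mk _ h) a = (h.1 a).eval 1 := by
  change Polynomial.aeval (1 : ℝ) (h.1 a) = _
  rw [Polynomial.coe_aeval_eq_eval]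

theorem ev_injective (x : A.base) : Function.Injective (A.ev x) := by
  intro s t h
  induction s using Quotient.inductionOn
  induction t using Quotient.inductionOn
  refine Quotient.sound fun a => ?_
  rw [← ev_mk, ← ev_mk, h]

/-- A real-valued algebra homomorphism as a filtered homomorphism to `𝔸`. -/
def ofReal (A : FPAB.{u}) (x : A.base) (h : A.fib x →ₐ[ℝ] ℝ) : A.Spec x :=
  Quotient.mk _ ⟨(Algebra.ofId ℝ AA).comp h, fun _ a _ =>
    (Polynomial.natDegree_C (h a)).le.trans (Nat.zero_le _)⟩

theorem ev_ofReal (x : A.base) (h : A.fib x →ₐ[ℝ] ℝ) : A.ev x (A.ofReal x h) = h := by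
  refine AlgHom.ext fun a => ?_
  exact (ev_mk x _ a).trans Polynomial.eval_C

/-- The topology of a fibre: pointwise convergence of the values. -/
instance (A : FPAB.{u}) (x : A.base) : TopologicalSpace (A.Spec x) :=
  TopologicalSpace.induced (fun s a => A.ev x s a) Pi.topologicalSpace

/-- The coordinates on the reconstructed bundle given by a trivialization: the values on the
generators of the polynomial algebra. -/
def specCoord (e : AlgTriv A.base A.rank A.fib A.fil) {x : A.base} (hx : x ∈ e.baseSet)
    (s : A.Spec x) : A.rank.Space := fun i => A.ev x s ((e.iso x hx).symm (MvPolynomial.X i))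

theorem ev_eq_eval (e : AlgTriv A.base A.rank A.fib A.fil) {x : A.base} (hx : x ∈ e.baseSet)
    (s : A.Spec x) (a : A.fib x) :
    A.ev x s a = MvPolynomial.eval (specCoord e hx s) (e.iso x hx a) := by
  have : (A.ev x s).comp (e.iso x hx).symm.toAlgHom = MvPolynomial.aeval (specCoord e hx s) :=
    MvPolynomial.algHom_ext fun i => by rw [MvPolynomial.aeval_X]; rfl
  have h := DFunLike.congr_fun this (e.iso x hx a)
  refine Eq.trans ?_ (h.trans (DFunLike.congr_fun (MvPolynomial.coe_aeval_eq_eval _) _))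
  exact congrArg (A.ev x s) ((e.iso x hx).symm_apply_apply a).symm

/-- The point with given coordinates. -/
def specPoint (e : AlgTriv A.base A.rank A.fib A.fil) {x : A.base} (hx : x ∈ e.baseSet)
    (y : A.rank.Space) : A.Spec x :=
  A.ofReal x ((MvPolynomial.aeval y).comp (e.iso x hx).toAlgHom)

theorem specCoord_specPoint (e : AlgTriv A.base A.rank A.fib A.fil) {x : A.base}
    (hx : x ∈ e.baseSet) (y : A.rank.Space) : specCoord e hx (specPoint e hx y) = y := by
  funext i
  rw [specCoord, specPoint, ev_ofReal]
  change MvPolynomial.aeval y (e.iso x hx ((e.iso x hx).symm (MvPolynomial.X i))) = _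
  rw [AlgEquiv.apply_symm_apply, MvPolynomial.aeval_X]

theorem specCoord_injective (e : AlgTriv A.base A.rank A.fib A.fil) {x : A.base}
    (hx : x ∈ e.baseSet) : Function.Injective (specCoord e hx) := fun s t h =>
  ev_injective x (AlgHom.ext fun a => by rw [ev_eq_eval e hx, ev_eq_eval e hx, h])

theorem specPoint_specCoord (e : AlgTriv A.base A.rank A.fib A.fil) {x : A.base}
    (hx : x ∈ e.baseSet) (s : A.Spec x) : specPoint e hx (specCoord e hx s) = s :=
  specCoord_injective e hx (specCoord_specPoint e hx _)

instance (A : FPAB.{u}) (x : A.base) : Nonempty (A.Spec x) :=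
  let ⟨e, _, hx⟩ := A.exists_triv x
  ⟨specPoint e hx 0⟩

open Classical in
/-- The local trivialization of the reconstructed bundle given by one of the algebra bundle. -/
def specTriv (e : AlgTriv A.base A.rank A.fib A.fil) :
    Bundle.Pretrivialization A.rank.Space (Bundle.TotalSpace.proj (F := A.rank.Space) (E := A.Spec))
    where
  toFun p := (p.1, if hx : p.1 ∈ e.baseSet then specCoord e hx p.2 else 0)
  invFun q := ⟨q.1, if hx : q.1 ∈ e.baseSet then specPoint e hx q.2 else Classical.arbitrary _⟩
  source := Bundle.TotalSpace.proj ⁻¹' e.baseSet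
  target := e.baseSet ×ˢ Set.univ
  map_source' := fun _ hp => ⟨hp, trivial⟩
  map_target' := fun _ hq => hq.1
  left_inv' := by
    rintro ⟨x, s⟩ hp
    have hx : x ∈ e.baseSet := hp
    simp [hx, specPoint_specCoord]
  right_inv' := by
    rintro ⟨x, y⟩ hq
    have hx : x ∈ e.baseSet := hq.1
    simp [hx, specCoord_specPoint]
  open_target := e.open_baseSet.prod isOpen_univ
  baseSet := e.baseSet
  open_baseSet := e.open_baseSet
  source_eq := rfl
  target_eq := rfl
  proj_toFun := fun _ _ => rfl

theorem specTriv_apply (e : AlgTriv A.base A.rank A.fib A.fil) {x : A.base}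
    (hx : x ∈ e.baseSet) (s : A.Spec x) : specTriv e ⟨x, s⟩ = (x, specCoord e hx s) := by
  exact Prod.ext rfl (dif_pos hx)

theorem specTriv_symm_apply (e : AlgTriv A.base A.rank A.fib A.fil) {x : A.base}
    (hx : x ∈ e.baseSet) (y : A.rank.Space) :
    (specTriv e).invFun (x, y) = ⟨x, specPoint e hx y⟩ := by
  exact congrArg (Bundle.TotalSpace.mk x) (dif_pos hx)

/-- The map induced on fibres by a morphism: composition of filtered homomorphisms. -/
def specMap (α : Hom A B) (x : B.base) : B.Spec x → A.Spec (α.base x) :=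
  Quotient.map (fun h => ⟨h.1.comp (α.fib x), fun n a ha => h.2 n _ (α.map_fil x n a ha)⟩)
    fun _ _ hh a => hh (α.fib x a)

theorem ev_specMap (α : Hom A B) (x : B.base) (s : B.Spec x) (a : A.fib (α.base x)) :
    A.ev (α.base x) (specMap α x s) a = B.ev x s (α.fib x a) := by
  induction s using Quotient.inductionOn
  rw [ev_mk]
  exact ev_mk _ _ _

theorem specMap_id (x : A.base) (s : A.Spec x) : specMap (Hom.id A) x s = s := by
  induction s using Quotient.inductionOn
  rfl

theorem isFiltered_specMap (α : Hom A B) {e : AlgTriv A.base A.rank A.fib A.fil}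
    (he : e ∈ A.atlas) {e' : AlgTriv B.base B.rank B.fib B.fil} (he' : e' ∈ B.atlas) :
    IsFiltered (e'.baseSet ∩ α.base ⁻¹' e.baseSet) B.rank A.rank fun x y =>
      (specTriv e ⟨α.base ((specTriv e').invFun (x, y)).1,
        specMap α _ ((specTriv e').invFun (x, y)).2⟩).2 := by
  obtain ⟨T, hT1, hT2⟩ := α.smooth e he e' he'
  refine ⟨T, hT1, fun x hx i => ⟨?_, fun y => ?_⟩⟩
  · rw [← hT2 x hx i]
    exact (e'.mem_fil x hx.1 _ _).1
      (α.map_fil x _ _ (symm_mem_fil e hx.2 (A.rank.X_mem_fil i)))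
  · change (specTriv e ⟨α.base ((specTriv e').invFun (x, y)).1,
        specMap α _ ((specTriv e').invFun (x, y)).2⟩).2 i = _
    rw [specTriv_symm_apply e' hx.1, specTriv_apply e hx.2, ← hT2 x hx i]
    change A.ev _ (specMap α x (specPoint e' hx.1 y)) _ = _
    rw [ev_specMap, ev_eq_eval e' hx.1, specCoord_specPoint]
    rfl

/-- The transition functions of the reconstructed bundle. -/
theorem isFiltered_specTriv {e e' : AlgTriv A.base A.rank A.fib A.fil} (he : e ∈ A.atlas)
    (he' : e' ∈ A.atlas) : IsFiltered (e.baseSet ∩ e'.baseSet) A.rank A.rank fun x y =>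
      (specTriv e' ((specTriv e).invFun (x, y))).2 :=
  (isFiltered_specMap (Hom.id A) he' he).congr fun x _ y => by
    rw [specMap_id]
    rfl

theorem isInducing_specCoord (e : AlgTriv A.base A.rank A.fib A.fil) {x : A.base}
    (hx : x ∈ e.baseSet) : Topology.IsInducing (specCoord e hx) := by
  constructor
  refine le_antisymm ?_ ?_
  · rw [← continuous_iff_le_induced]
    exact continuous_pi fun i => (continuous_apply _).comp continuous_induced_dom
  · let _ : TopologicalSpace (A.Spec x) := TopologicalSpace.induced (specCoord e hx) inferInstance
    refine continuous_iff_le_induced.1 (continuous_pi fun a => ?_)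
    simp only [ev_eq_eval e hx]
    exact (MvPolynomial.continuous_eval (e.iso x hx a)).comp continuous_induced_dom

theorem IsFiltered.continuousOn {M : SmoothMfd.{u}} {U : Set M} {d d' : Rank}
    {g : M → d.Space → d'.Space} (h : IsFiltered U d d' g) :
    ContinuousOn (fun q : M × d.Space => g q.1 q.2) (U ×ˢ Set.univ) := by
  obtain ⟨T, h1, h2⟩ := h
  refine continuousOn_pi.2 fun i => ?_
  have : ContinuousOn (fun q : M × d.Space => ∑ m ∈ (d.finite_weight_le (d'.wt i)).toFinset,
      MvPolynomial.coeff m (T q.1 i) * ∏ j, q.2 j ^ m j) (U ×ˢ Set.univ) := by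
    refine continuousOn_finsetSum _ fun m _ => ContinuousOn.mul ?_ ?_
    · exact (h1 i m).continuousOn.comp continuousOn_fst fun q hq => hq.1
    · exact Continuous.continuousOn (by fun_prop)
  refine this.congr fun q hq => ?_
  rw [(h2 q.1 hq.1 i).2, MvPolynomial.eval_eq']
  refine Finset.sum_subset_zero_on_sdiff (fun m hm => ?_) (fun m hm => ?_) (fun m _ => rfl)
  · simpa using Rank.mem_fil.1 (h2 q.1 hq.1 i).1 m hm
  · have := (Finset.mem_sdiff.1 hm).2
    rw [MvPolynomial.notMem_support_iff] at this
    simp [this]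

/-- The local trivializations glue the fibres to a fibre bundle. -/
def specPrebundle (A : FPAB.{u}) : FiberPrebundle A.rank.Space A.Spec where
  pretrivializationAtlas := {t | ∃ e ∈ A.atlas, t = specTriv e}
  pretrivializationAt x := specTriv (A.exists_triv x).choose
  mem_base_pretrivializationAt x := (A.exists_triv x).choose_spec.2
  pretrivialization_mem_atlas x := ⟨_, (A.exists_triv x).choose_spec.1, rfl⟩
  continuous_trivChange := by
    rintro _ ⟨e', he', rfl⟩ _ ⟨e, he, rfl⟩
    have h := IsFiltered.continuousOn (isFiltered_specTriv he he')
    refine (continuousOn_fst.prodMk (h.mono ?_)).congr ?_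
    · rintro ⟨x, y⟩ ⟨hq1, hq2⟩
      exact ⟨⟨hq1.1, hq2⟩, trivial⟩
    · rintro ⟨x, y⟩ ⟨hq1, hq2⟩
      rfl
  totalSpaceMk_isInducing x := by
    have hx := (A.exists_triv x).choose_spec.2
    have : specTriv (A.exists_triv x).choose ∘ Bundle.TotalSpace.mk x =
        (fun y => (x, y)) ∘ specCoord (A.exists_triv x).choose hx :=
      funext fun s => specTriv_apply _ hx s
    rw [this]
    exact (isInducing_prodMkRight x).comp (isInducing_specCoord _ hx)

/-- The filtered bundle reconstructed from a filtered polynomial algebra bundle. -/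
abbrev spec (A : FPAB.{u}) : FilB.{u} :=
  letI := A.specPrebundle.totalSpaceTopology
  letI := A.specPrebundle.toFiberBundle
  { base := A.base
    rank := A.rank
    fib := A.Spec
    filtered := by
      rintro _ ⟨_, ⟨e, he, rfl⟩, rfl⟩ _ ⟨_, ⟨e', he', rfl⟩, rfl⟩
      exact isFiltered_specTriv he he' }

/-- The morphism of filtered bundles induced by a morphism of algebra bundles. -/
def specHom (α : Hom A B) : FilB.Hom B.spec A.spec where
  base := α.base
  smooth := α.smooth_base
  fib := specMap α
  filtered := by
    rintro _ ⟨_, ⟨e', he', rfl⟩, rfl⟩ _ ⟨_, ⟨e, he, rfl⟩, rfl⟩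
    exact isFiltered_specMap α he he'

theorem specHom_id (A : FPAB.{u}) : specHom (Hom.id A) = FilB.Hom.id A.spec := by
  have : specMap (Hom.id A) = fun _ s => s := funext fun x => funext fun s => specMap_id x s
  simp only [specHom, FilB.Hom.id]
  congr 1

theorem specHom_comp (α : Hom A B) (β : Hom B C) :
    specHom (α.comp β) = (specHom β).comp (specHom α) := by
  have : specMap (α.comp β) = fun x s => specMap α (β.base x) (specMap β x s) :=
    funext fun x => funext fun s => by
      induction s using Quotient.inductionOn
      rfl
  simp only [specHom, FilB.Hom.comp]
  congr 1

/-- The functor `A ↦ Hom_{f-alg}(A, 𝔸)`; on morphisms it is composition with the morphism. -/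
def specFunctor : CategoryTheory.Functor FPAB.{u} FilB.{u}ᵒᵖ where
  obj A := Opposite.op A.spec
  map {A B} α := Quiver.Hom.op (show B.spec ⟶ A.spec from specHom α)
  map_id A := congrArg Quiver.Hom.op (specHom_id A)
  map_comp α β := congrArg Quiver.Hom.op (specHom_comp α β)

end FPAB

/-- The evaluation at a point `p` of a filtered bundle, as a point of the reconstructed bundle. -/
def evalPoint (F : FilB.{u}) {x : F.base} (p : F.fib x) : F.dual.Spec x :=
  F.dual.ofReal x ((Pi.evalAlgHom ℝ (fun _ => ℝ) p).comp (F.val x))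

end

end FiltDual

namespace FiltDual

noncomputable section

/-! ### Evaluation at points -/

namespace FilB

variable {F G : FilB.{u}}

/-! On a single fibre this is the duality between the affine space `ℝ^d` and its polynomial algebra.
At `ε = 1` a filtered morphism `F_x → 𝔸` becomes a polynomial function on `F_x`, and a filtered
algebra homomorphism `A_x → 𝔸` becomes a real character of `A_x`. A character of `𝒜(ℝ^d)` takes
arbitrary values on the generators and is determined by them, so it is the evaluation at exactly one
point of `ℝ^d`.

Over the base, a trivialization `e` induces `dualTriv` on the dual and `specTriv` on the
reconstructed bundle. The same weighted polynomials `T i` describe a change of fibre coordinates and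
the algebra automorphism sending the generator `X i` to `T i`. A bidual therefore has the transition
functions of the original bundle.

The two identifications with the bidual come from the pairing of functions with points: a point `p`
goes to `a ↦ a(p)` (`evalPoint`), and an element `a` goes to the function `s ↦ s(a)` (`gelfand`).
Both are the identity in corresponding charts (`specCoord_evalPoint`, `bidualTriv_gelfand`). They
are thus bijective, and the conditions for them and their inverses to be morphisms reduce to those
on transition functions. Naturality (`evalPoint_fib`, `gelfand_fib`) is the adjointness of pullback
and pushforward under the pairing. It is checked on values, which determine points by `ev_injective`
and functions by `val_injective`. -/

theorem Hom.eq_of_fib {b : F.base → G.base} {h h' : ContMDiff (𝓡 F.base.dim) (𝓡 G.base.dim) ∞ b}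
    {f f' : ∀ x, F.fib x → G.fib (b x)} {k k'} (hf : ∀ x p, f x p = f' x p) :
    (⟨b, h, f, k⟩ : Hom F G) = ⟨b, h', f', k'⟩ := by
  obtain rfl : f = f' := funext fun x => funext fun p => hf x p
  rfl

/-- A point of the total space over the base set is recovered by `e.invFun` from its base point and
its fibre coordinates, and here the base points coincide. -/
theorem coord_injective {e : F.Triv} {x : F.base} (hx : x ∈ e.baseSet) :
    Function.Injective (F.coord e : F.fib x → F.rank.Space) := fun p q h => by
  have hp := invFun_apply (e := e) (p := (⟨x, p⟩ : F.Tot)) hx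
  have hq := invFun_apply (e := e) (p := (⟨x, q⟩ : F.Tot)) hx
  rw [show (e ⟨x, p⟩).2 = (e ⟨x, q⟩).2 from h] at hp
  -- Equality in the total space gives only a heterogeneous equality of the second components; both
  -- lie in the fibre over `x`, so it is an honest one.
  exact eq_of_heq (Bundle.TotalSpace.mk.inj (hp.symm.trans hq)).2

/-- The pairing identity behind all computations with `evalPoint`: it frees them from the
representative in `𝔸` chosen by `ofReal`. -/
theorem ev_evalPoint {x : F.base} (p : F.fib x) (a : F.Dual x) :
    F.dual.ev x (evalPoint F p) a = F.val x a p :=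
  DFunLike.congr_fun (FPAB.ev_ofReal (A := F.dual) x _) a

/-- Coordinates of a character are its values on the generators, and under `dualTriv` the generator
`X i` is the `i`-th coordinate function. In charts, evaluation is therefore the identity of `ℝ^d`.
-/
theorem specCoord_evalPoint {e : F.Triv} (he : e ∈ F.atlas) {x : F.base} (hx : x ∈ e.baseSet)
    (p : F.fib x) :
    FPAB.specCoord (A := F.dual) (dualTriv he) hx (evalPoint F p) = F.coord e p := by
  funext i
  refine (ev_evalPoint p _).trans ?_
  rw [val_dualTriv_symm, MvPolynomial.eval_X]

/-- In a chart this is a comparison of two coordinate systems: `coord` is injective and reaches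
every vector, `specCoord` is injective, and `evalPoint` intertwines them. -/
theorem evalPoint_bijective (x : F.base) :
    Function.Bijective (evalPoint F : F.fib x → F.dual.Spec x) := by
  obtain ⟨e, he, hx⟩ := F.exists_triv x
  constructor
  · intro p q h
    refine coord_injective hx ?_
    rw [← specCoord_evalPoint he hx, h, specCoord_evalPoint he hx]
  · intro s
    obtain ⟨p, hp⟩ := exists_coord_eq hx (FPAB.specCoord (A := F.dual) (dualTriv he) hx s)
    exact ⟨p, FPAB.specCoord_injective (A := F.dual) (dualTriv he) hx
      ((specCoord_evalPoint he hx p).trans hp)⟩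

/-- A fibre is identified with the fibre of the bidual by evaluation. -/
def evalEquiv (F : FilB.{u}) (x : F.base) : F.fib x ≃ F.dual.Spec x :=
  Equiv.ofBijective _ (evalPoint_bijective x)

theorem coord_evalEquiv_symm {e : F.Triv} (he : e ∈ F.atlas) {x : F.base} (hx : x ∈ e.baseSet)
    (s : F.dual.Spec x) :
    F.coord e ((F.evalEquiv x).symm s) = FPAB.specCoord (A := F.dual) (dualTriv he) hx s := by
  rw [← specCoord_evalPoint he hx]
  exact congrArg _ ((F.evalEquiv x).apply_symm_apply s)

/-- The evaluation at points as a morphism to the bidual. -/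
def evalHom (F : FilB.{u}) : Hom F F.dual.spec where
  base := _root_.id
  smooth := contMDiff_id
  fib := fun _ p => evalPoint F p
  filtered := by
    rintro e he _ ⟨_, ⟨_, ⟨e', he', rfl⟩, rfl⟩, rfl⟩
    -- Since evaluation is the identity in charts, its local expression is the transition function
    -- of `F` from `e` to `e'`.
    refine (F.filtered e he e' he').congr fun x hx y => ?_
    -- The point to be evaluated lies over `(e.invFun (x, y)).1`, which equals `x` only
    -- propositionally, so the membership has to be transported.
    have h : (e.invFun (x, y)).1 ∈ e'.baseSet := by rw [invFun_fst hx.1]; exact hx.2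
    refine (congrArg Prod.snd (FPAB.specTriv_apply (A := F.dual) (dualTriv he') h _)).trans ?_
    exact specCoord_evalPoint he' h _

/-- The inverse of the evaluation at points. -/
def evalInv (F : FilB.{u}) : Hom F.dual.spec F where
  base := _root_.id
  smooth := contMDiff_id
  fib := fun x s => (F.evalEquiv x).symm s
  filtered := by
    rintro _ ⟨_, ⟨_, ⟨e, he, rfl⟩, rfl⟩, rfl⟩ e' he'
    refine (F.filtered e he e' he').congr fun x hx y => ?_
    have hx1 : x ∈ e.baseSet := hx.1
    change (e' (⟨((FPAB.specTriv (A := F.dual) (dualTriv he)).invFun (x, y)).1,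
      (F.evalEquiv _).symm ((FPAB.specTriv (A := F.dual) (dualTriv he)).invFun (x, y)).2⟩ :
        F.Tot)).2 = (e' (e.invFun (x, y))).2
    rw [FPAB.specTriv_symm_apply (A := F.dual) (dualTriv he) hx1]
    -- What remains is an equality of points of `F`: the preimage of `specPoint` under evaluation is
    -- rebuilt from its own coordinates in `e`, and these are `y`.
    refine congrArg (fun q : F.Tot => (e' q).2) ?_
    refine (invFun_apply (e := e)
      (p := (⟨x, (F.evalEquiv x).symm (FPAB.specPoint (A := F.dual) (dualTriv he) hx1 y)⟩ : F.Tot))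
      hx1).symm.trans ?_
    refine congrArg (fun z => e.invFun (x, z)) ((coord_evalEquiv_symm he hx1 _).trans ?_)
    exact FPAB.specCoord_specPoint (A := F.dual) (dualTriv he) hx1 y

/-- A filtered bundle is isomorphic to its bidual. -/
def evalIso (F : FilB.{u}) : F ≅ F.dual.spec where
  hom := evalHom F
  inv := evalInv F
  -- The base maps of the composite and of the identity agree definitionally, so only the maps on
  -- fibres are compared.
  hom_inv_id := Hom.eq_of_fib (F := F) (G := F) fun x p => (F.evalEquiv x).symm_apply_apply p
  inv_hom_id := Hom.eq_of_fib (F := F.dual.spec) (G := F.dual.spec)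
    fun x s => (F.evalEquiv x).apply_symm_apply s

/-- Both characters send `a` to the value of `a` at the image of `p`: pulling `a` back and
evaluating at `p` is evaluating `a` at the image. -/
theorem evalPoint_fib (φ : Hom F G) (x : F.base) (p : F.fib x) :
    evalPoint G (φ.fib x p) = FPAB.specMap (dualHom φ) x (evalPoint F p) := by
  refine FPAB.ev_injective (A := G.dual) _ (AlgHom.ext fun a => ?_)
  refine (ev_evalPoint _ a).trans (Eq.symm ?_)
  refine (FPAB.ev_specMap (dualHom φ) x _ a).trans ((ev_evalPoint p _).trans ?_)
  exact val_dualMap φ x a p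

theorem evalHom_naturality (φ : Hom F G) :
    φ.comp (evalHom G) = (evalHom F).comp (FPAB.specHom (dualHom φ)) :=
  Hom.eq_of_fib (F := F) (G := G.dual.spec) fun x p => evalPoint_fib φ x p

/-- Evaluation is a natural isomorphism between the bidual and the identity. -/
def evalNatIso : CategoryTheory.Functor.id FilB.{u}ᵒᵖ ≅
    CategoryTheory.Functor.comp dualFunctor FPAB.specFunctor :=
  -- Passing to the opposite category reverses `evalIso`, so these components lead from the bidual
  -- to the identity. Hence the outer `symm`, and hence evaluation sits in the inverse of the
  -- resulting isomorphism.
  (CategoryTheory.NatIso.ofComponents (fun F => (evalIso F.unop).op) fun φ =>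
    congrArg Quiver.Hom.op (evalHom_naturality φ.unop).symm).symm

end FilB

/-! ### Elements of an algebra bundle as functions on the reconstructed bundle -/

namespace FPAB

variable {A B : FPAB.{u}}

theorem Hom.eq_of_fib {b : B.base → A.base} {h h' : ContMDiff (𝓡 B.base.dim) (𝓡 A.base.dim) ∞ b}
    {f f' : ∀ x, A.fib (b x) →ₐ[ℝ] B.fib x} {k k' l l'} (hf : ∀ x a, f x a = f' x a) :
    (⟨b, h, f, k, l⟩ : Hom A B) = ⟨b, h', f', k', l'⟩ := by
  obtain rfl : f = f' := funext fun x => AlgHom.ext (hf x)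
  rfl

/-- The trivialization of the bidual given by one of the algebra bundle. -/
def bidualTriv {e : AlgTriv A.base A.rank A.fib A.fil} (he : e ∈ A.atlas) :
    AlgTriv A.base A.rank A.spec.Dual A.spec.dualFil :=
  FilB.dualTriv (F := A.spec) ⟨specTriv e, ⟨e, he, rfl⟩, rfl⟩

/-- An instance of `FilB.eval_dualTriv`, with the fibre coordinate of `specTriv`, defined by cases
on the base set, replaced by `specCoord`. -/
theorem eval_bidualTriv {e : AlgTriv A.base A.rank A.fib A.fil} (he : e ∈ A.atlas) {x : A.base}
    (hx : x ∈ e.baseSet) (a : A.spec.Dual x) (s : A.Spec x) :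
    MvPolynomial.eval (specCoord e hx s) ((bidualTriv he).iso x hx a) = A.spec.val x a s :=
  (congrArg (fun y => MvPolynomial.eval y ((bidualTriv he).iso x hx a))
    (congrArg Prod.snd (specTriv_apply e hx s)).symm).trans
    (FilB.eval_dualTriv (F := A.spec) ⟨specTriv e, ⟨e, he, rfl⟩, rfl⟩ hx a s)

/-- An element of the fibre of an algebra bundle as a function on the reconstructed fibre. -/
def gelfand (A : FPAB.{u}) (x : A.base) : A.fib x ≃ₐ[ℝ] A.spec.Dual x :=
  -- Composing two charts over one chosen trivialization makes this an algebra isomorphism by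
  -- construction; `val_gelfand` recovers the intrinsic formula.
  ((A.exists_triv x).choose.iso x (A.exists_triv x).choose_spec.2).trans
    ((bidualTriv (A.exists_triv x).choose_spec.1).iso x (A.exists_triv x).choose_spec.2).symm

/-- Both sides are the value of one polynomial, the expression of `a` in the chosen chart, at the
coordinates of `s`. The formula does not involve that chart, so by injectivity of `val` the choice
in `gelfand` is immaterial. -/
theorem val_gelfand (x : A.base) (a : A.fib x) (s : A.Spec x) :
    A.spec.val x (A.gelfand x a) s = A.ev x s a := by
  have hx := (A.exists_triv x).choose_spec.2
  rw [← eval_bidualTriv (A.exists_triv x).choose_spec.1 hx, ev_eq_eval _ hx, gelfand,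
    AlgEquiv.trans_apply, AlgEquiv.apply_symm_apply]

/-- This holds for every chart, not only the one used to define `gelfand`, because a real polynomial
is determined by its values and the values of both sides are given by the pairing. -/
theorem bidualTriv_gelfand {e : AlgTriv A.base A.rank A.fib A.fil} (he : e ∈ A.atlas) {x : A.base}
    (hx : x ∈ e.baseSet) (a : A.fib x) :
    (bidualTriv he).iso x hx (A.gelfand x a) = e.iso x hx a := by
  refine MvPolynomial.funext fun y => ?_
  -- Every vector `y` is the coordinate vector of a character, so the pairing formulas apply at `y`.
  rw [← specCoord_specPoint e hx y, eval_bidualTriv he hx, val_gelfand, ev_eq_eval e hx]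

theorem gelfand_symm_bidualTriv_symm {e : AlgTriv A.base A.rank A.fib A.fil} (he : e ∈ A.atlas)
    {x : A.base} (hx : x ∈ e.baseSet) (P : A.rank.Alg) :
    (A.gelfand x).symm (((bidualTriv he).iso x hx).symm P) = (e.iso x hx).symm P := by
  rw [AlgEquiv.symm_apply_eq, AlgEquiv.symm_apply_eq, bidualTriv_gelfand he hx,
    AlgEquiv.apply_symm_apply]

/-- In charts both filtrations are the weighted degree filtration and `gelfand` is the identity.
Both directions are needed: one for `gelfandHom`, the other for its inverse. -/
theorem gelfand_mem_dualFil {x : A.base} {n : ℕ} {a : A.fib x} :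
    A.gelfand x a ∈ A.spec.dualFil x n ↔ a ∈ A.fil x n := by
  obtain ⟨e, he, hx⟩ := A.exists_triv x
  rw [(bidualTriv he).mem_fil x hx, bidualTriv_gelfand he hx, e.mem_fil x hx]

/-- The morphism from an algebra bundle to its bidual. -/
def gelfandHom (A : FPAB.{u}) : Hom A A.spec.dual where
  base := _root_.id
  smooth_base := contMDiff_id
  fib := fun x => (A.gelfand x).toAlgHom
  map_fil := fun _ _ _ h => gelfand_mem_dualFil.2 h
  smooth := by
    rintro e he _ ⟨_, ⟨_, ⟨e', he', rfl⟩, rfl⟩, rfl⟩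
    -- The local expression is the transition automorphism of `A` from `e` to `e'`; the base sets
    -- are swapped because a morphism lists the chart of its target first.
    refine ((A.smooth e he e' he').mono (V := e'.baseSet ∩ e.baseSet)
      fun x hx => ⟨hx.2, hx.1⟩).congr fun x hx => AlgHom.ext fun P => ?_
    exact bidualTriv_gelfand he' hx.1 _

/-- The morphism from the bidual of an algebra bundle back to it. -/
def gelfandInv (A : FPAB.{u}) : Hom A.spec.dual A where
  base := _root_.id
  smooth_base := contMDiff_id
  fib := fun x => (A.gelfand x).symm.toAlgHom
  map_fil := fun x n a h => gelfand_mem_dualFil.1 (by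
    change A.gelfand x ((A.gelfand x).symm a) ∈ _
    rwa [AlgEquiv.apply_symm_apply])
  smooth := by
    rintro _ ⟨_, ⟨_, ⟨e, he, rfl⟩, rfl⟩, rfl⟩ e' he'
    refine ((A.smooth e he e' he').mono (V := e'.baseSet ∩ e.baseSet)
      fun x hx => ⟨hx.2, hx.1⟩).congr fun x hx => AlgHom.ext fun P => ?_
    exact congrArg (e'.iso x hx.1) (gelfand_symm_bidualTriv_symm he hx.2 P)

/-- An algebra bundle is isomorphic to its bidual. -/
def gelfandIso (A : FPAB.{u}) : A ≅ A.spec.dual where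
  hom := gelfandHom A
  inv := gelfandInv A
  hom_inv_id := Hom.eq_of_fib (A := A) (B := A) fun x a => (A.gelfand x).symm_apply_apply a
  inv_hom_id := Hom.eq_of_fib (A := A.spec.dual) (B := A.spec.dual)
    fun x a => (A.gelfand x).apply_symm_apply a

/-- As functions of a character `s` of the fibre of `B`, both sides take the value of `s` on the
image of `a`, since `specMap` is precomposition with `α`. -/
theorem gelfand_fib (α : Hom A B) (x : B.base) (a : A.fib (α.base x)) :
    B.gelfand x (α.fib x a) = FilB.dualMap (specHom α) x (A.gelfand (α.base x) a) := by
  refine FilB.val_injective (F := B.spec) x (funext fun s => ?_)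
  refine (val_gelfand x _ s).trans (Eq.symm ?_)
  refine (FilB.val_dualMap (specHom α) x _ s).trans ((val_gelfand _ a _).trans ?_)
  exact ev_specMap α x s a

theorem gelfandHom_naturality (α : Hom A B) :
    α.comp (gelfandHom B) = (gelfandHom A).comp (FilB.dualHom (specHom α)) :=
  Hom.eq_of_fib (A := A) (B := B.spec.dual) fun x a => gelfand_fib α x a

/-- The identity is naturally isomorphic to the bidual. -/
def gelfandNatIso : CategoryTheory.Functor.id FPAB.{u} ≅
    CategoryTheory.Functor.comp specFunctor FilB.dualFunctor :=
  CategoryTheory.NatIso.ofComponents gelfandIso fun α => gelfandHom_naturality α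

end FPAB

end

end FiltDual

open CategoryTheory Opposite FiltDual in
/-- Duality: `F ↦ Hom_f(F, 𝔸)` and `A ↦ Hom_{f-alg}(A, 𝔸)` are quasi-inverse (contravariant)
equivalences between filtered bundles and filtered polynomial algebra bundles, and the identification
of a filtered bundle with its bidual is the evaluation at points. -/
theorem mainTheorem9 :
    (∃ e : FilB.{u}ᵒᵖ ≌ FPAB.{u}, e.functor = FilB.dualFunctor ∧ e.inverse = FPAB.specFunctor) ∧
    ∃ η : 𝟭 FilB.{u}ᵒᵖ ≅ FilB.dualFunctor ⋙ FPAB.specFunctor, ∀ (F : FilB.{u}) (p : F.Tot),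
      FilB.Hom.tot (G := F.dual.spec) (η.inv.app (op F)).unop p = ⟨p.1, evalPoint F p.2⟩ :=
  -- This constructor needs no triangle identity, as it adjusts the unit. The statement about
  -- evaluation is therefore made for `FilB.evalNatIso` itself, where it holds by definition.
  ⟨⟨.mk FilB.dualFunctor FPAB.specFunctor FilB.evalNatIso FPAB.gelfandNatIso.symm, rfl, rfl⟩,
    FilB.evalNatIso, fun _ _ => rfl⟩
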